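/- Let $K\subset\mathbb{C}$ be a quadratic number field with ring of integers $\mathcal O_K$ and discriminant $\Delta_K$, and let $\sqrt{\Delta_K}\in\mathbb{C}$ be a square root of $\Delta_K$. Let $m\neq 1$ be a square-free integer, $\sqrt m\in\mathbb{C}$ a square root of $m$, and $F=\mathbb{Q}(\sqrt m)$ with $\operatorname{Gal}(F/\mathbb{Q})=\{1,\sigma\}$. Let $\alpha=p+q\sqrt{\Delta_K}\in K$ with $p,q\in\mathbb{Q}$ and $N_{K/\mathbb{Q}}(\alpha)=m$ (so $q\neq 0$). Let $f=\sum_{n\ge 1}a_nq^n\in S_2(\Gamma_1(N),\varepsilon)$ be a normalized newform whose Fourier coefficients generate $F$, and write ${}^\sigma\! f=\sum_{n\ge1}\sigma(a_n)q^n$. Put $$\beta=\frac pq+\frac1q\sqrt m,\qquad \kappa=\frac{\sqrt{\Delta_K}}{\beta},\qquad h=\frac{1}{1+\kappa}\left(f+\kappa\,{}^\sigma\! f\right).$$ (This includes the case of a $\mathbb{Q}$-curve $E$ without CM completely defined over $K$, with an isogeny $\mu\colon E\to{}^\nu\! E$ to its conjugate such that ${}^\nu\!\mu\mu=m$, invariant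 differentials with $\mu^*\omega_{{}^\nu\! E}=\alpha\,\omega_E$ where $N_{K/\mathbb{Q}}(\alpha)=m$, and $f$ a newform attached to $E$; then $h$ is the normalized form attached to these data.) Let $D_h=\{x\in K: x\cdot h\in\mathcal O_K[[q]]\}$ and $D_\alpha=\{x\in\mathcal O_K: x\alpha\in\mathcal O_K\}$. Then $D_h$ is an integral ideal of $\mathcal O_K$, and: * if $m\equiv 2,3\pmod 4$, then $N_{K/\mathbb{Q}}(D_h)\mid N_{K/\mathbb{Q}}(D_\alpha)$; * if $m\equiv 1\pmod 4$, then $N_{K/\mathbb{Q}}(D_h)\mid 4N_{K/\mathbb{Q}}(D_\alpha)$. In particular, if $\alpha\in\mathcal O_K$, then $N_{K/\mathbb{Q}}(D_h)=1$ if $m\equiv2,3\pmod 4$, and $N_{K/\mathbb{Q}}(D_h)\in\{1,2,4\}$ if $m\equiv 1\pmod 4$. -/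

import Mathlib

open scoped MatrixGroups ModularForm Modular NumberField PowerSeries
open UpperHalfPlane CongruenceSubgroup

noncomputable section

namespace QCurve

/-! ### Newforms of weight two on `Γ₁(N)` -/

/-- The space `S₂(Γ₁(N))` of cusp forms of weight two. -/
abbrev S₂ (N : ℕ) : Type := CuspForm ((Gamma1 N : Subgroup SL(2, ℤ)) : Subgroup (GL (Fin 2) ℝ)) 2

/-- The matrix with rows `(1, j)` and `(0, p)`. -/
def upperMatrix (p : ℕ) (hp : p ≠ 0) (j : ℕ) : GL (Fin 2) ℝ :=
  Matrix.GeneralLinearGroup.mkOfDetNeZero !![(1 : ℝ), (j : ℝ); 0, (p : ℝ)]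
    (by simpa [Matrix.det_fin_two] using hp)

/-- The matrix with rows `(d, 0)` and `(0, 1)`. -/
def scaleMatrix (d : ℕ) (hd : d ≠ 0) : GL (Fin 2) ℝ :=
  Matrix.GeneralLinearGroup.mkOfDetNeZero !![(d : ℝ), 0; 0, 1]
    (by simpa [Matrix.det_fin_two] using hd)

/-- The Hecke operator `T_p` in weight two on forms of nebentypus `ε` modulo `N`:
`T_p f = ∑_{0 ≤ j < p} f ∣ (1, j; 0, p) + ε(p) f ∣ (p, 0; 0, 1)`, where `ε(p) = 0` if `p ∣ N`. -/
def heckeT {N : ℕ} (ε : DirichletCharacter ℂ N) (p : ℕ) (hp : p ≠ 0) (f : ℍ → ℂ) : ℍ → ℂ :=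
  (∑ j ∈ Finset.range p, f ∣[(2 : ℤ)] upperMatrix p hp j) +
    ε (p : ZMod N) • (f ∣[(2 : ℤ)] scaleMatrix p hp)

/-- The Petersson inner product of two functions for which the Petersson integrand is
`Γ₁(N)`-invariant: the integral of `conj f * g * y ^ 2` against `dx dy / y ^ 2` over the translates
of the standard fundamental domain of `SL(2, ℤ)` by representatives of `Γ₁(N) \ SL(2, ℤ)`. -/
def peterssonInner (N : ℕ) (f g : ℍ → ℂ) : ℂ :=
  ∑ᶠ c : SL(2, ℤ) ⧸ Gamma1 N, ∫ τ in 𝒟, petersson 2 f g ((Quotient.out c)⁻¹ • τ)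

/-- `f` is a (normalized) newform in `S₂(Γ₁(N), ε)`: it has nebentypus `ε`, it is an eigenform of
all Hecke operators, it is orthogonal to all oldforms `z ↦ g(dz)` with `g ∈ S₂(Γ₁(M))`,
`dM ∣ N`, `M ≠ N`, and its first Fourier coefficient is `1`. -/
structure IsNewform {N : ℕ} (ε : DirichletCharacter ℂ N) (f : S₂ N) : Prop where
  nebentypus : ∀ γ ∈ Gamma0 N, (f : ℍ → ℂ) ∣[(2 : ℤ)] γ = ε ((γ 1 1 : ℤ) : ZMod N) • (f : ℍ → ℂ)
  eigen : ∀ (p : ℕ) (hp : p.Prime), ∃ c : ℂ, heckeT ε p hp.ne_zero f = c • (f : ℍ → ℂ)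
  new : ∀ (M d : ℕ) (hd : d ≠ 0), d * M ∣ N → M ≠ N → ∀ g : S₂ M,
    peterssonInner N ((g : ℍ → ℂ) ∣[(2 : ℤ)] scaleMatrix d hd) f = 0
  normalized : (qExpansion 1 (f : ℍ → ℂ)).coeff 1 = 1

/-- The number field generated by the Fourier coefficients of `f`, inside `ℂ`. -/
def coeffField {N : ℕ} (f : S₂ N) : IntermediateField ℚ ℂ :=
  IntermediateField.adjoin ℚ (Set.range fun n => (qExpansion 1 (f : ℍ → ℂ)).coeff n)

/-- The `n`-th Fourier coefficient of `f`, as an element of its coefficient field. -/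
def fourierCoeff {N : ℕ} (f : S₂ N) (n : ℕ) : coeffField f :=
  ⟨(qExpansion 1 (f : ℍ → ℂ)).coeff n, IntermediateField.subset_adjoin _ _ ⟨n, rfl⟩⟩

/-- The Fourier expansion of the conjugate of `f` by an automorphism `σ` of its coefficient
field. -/
def conjExpansion {N : ℕ} (f : S₂ N) (σ : Gal(coeffField f/ℚ)) : ℂ⟦X⟧ :=
  PowerSeries.mk fun n => ((σ (fourierCoeff f n) : coeffField f) : ℂ)

/-! ### The normalized form and denominator ideals -/

/-- The Fourier expansion of `h = (f + κ σ(f)) / (1 + κ)`. -/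
def hExpansion {N : ℕ} (f : S₂ N) (σ : Gal(coeffField f/ℚ)) (κ : ℂ) : ℂ⟦X⟧ :=
  PowerSeries.C (1 / (1 + κ)) *
    (qExpansion 1 (f : ℍ → ℂ) + PowerSeries.C κ * conjExpansion f σ)

section

variable {K : Type*} [Field K]

/-- The denominator of a power series `h` with respect to an embedding `ι : K → ℂ`: the set of
all `x ∈ K` such that `x • h` has coefficients in (the image of) `𝓞 K`. -/
def seriesDenominator (ι : K →+* ℂ) (h : ℂ⟦X⟧) : Submodule (𝓞 K) K where
  carrier := {x | ∃ g : (𝓞 K)⟦X⟧,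
    PowerSeries.C (ι x) * h = PowerSeries.map (ι.comp (algebraMap (𝓞 K) K)) g}
  zero_mem' := ⟨0, by simp⟩
  add_mem' := by
    rintro x y ⟨g, hg⟩ ⟨g', hg'⟩
    exact ⟨g + g', by rw [map_add, map_add, add_mul, hg, hg', map_add]⟩
  smul_mem' := by
    rintro c x ⟨g, hg⟩
    refine ⟨PowerSeries.C c * g, ?_⟩
    rw [Algebra.smul_def, map_mul, map_mul, mul_assoc, hg, map_mul, PowerSeries.map_C]
    rfl

/-- The denominator ideal `{x ∈ 𝓞 K : x α ∈ 𝓞 K}` of an element `α ∈ K`. -/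
def elementDenominator (α : K) : Ideal (𝓞 K) where
  carrier := {x | ∃ y : 𝓞 K, (x : K) * α = (y : K)}
  zero_mem' := ⟨0, by simp⟩
  add_mem' := by
    rintro x y ⟨a, ha⟩ ⟨b, hb⟩
    exact ⟨a + b, by push_cast; rw [add_mul, ha, hb]⟩
  smul_mem' := by
    rintro c x ⟨a, ha⟩
    exact ⟨c * a, by rw [smul_eq_mul]; push_cast; rw [mul_assoc, ha]⟩

end

end QCurve

end

/-! Write a_n = x_n + y_n √m with x_n, y_n rational, and let ᾱ = p - q√Δ be the conjugate of α.
Since αᾱ = m = (√m)², one has √m(ᾱ + √m) = ᾱ(α + √m). This is exactly what makes the normalization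
by κ replace √m by ᾱ: the n-th coefficient of h is x_n + y_n ᾱ (`normalization_identity`). If all
x_n, y_n are integers, anything that clears the denominator of ᾱ clears those of h, so D_ᾱ ⊆ D_h and
N(D_h) divides N(D_ᾱ) = N(D_α). In general 2x_n, 2y_n are integers, so 2D_ᾱ ⊆ D_h, which costs the
factor N(2) = 4. For m ≡ 2, 3 mod 4 the integers of ℚ(√m) have integral coordinates. Finally D_h is
integral because a_1 = 1. The deep input is that the a_n are algebraic integers
(`IsNewform.isIntegral_coeff`). A primitive P of f has limits at all cusps. By Manin's trick these
span a finitely generated group, and together with the character values they give a nonzero finitely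
generated ℤ-module stable under the Hecke eigenvalues. Hence the eigenvalues are integral, and the
Hecke recursion passes this on to all a_n. -/

namespace QCurve

/-! ### Primitives of functions on the upper half plane -/

section Primitive

open Filter Topology
open scoped Manifold

/-- `P` is a holomorphic primitive of `f` on the upper half plane. -/
def IsPrimitive (P f : ℍ → ℂ) : Prop :=
  ∀ z : ℍ, HasDerivAt (P ∘ ofComplex) (f z) z

theorem IsPrimitive.mdifferentiable {P f : ℍ → ℂ} (h : IsPrimitive P f) : MDiff P := fun z ↦
  UpperHalfPlane.mdifferentiableAt_iff.mpr (h z).differentiableAt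

theorem IsPrimitive.add {P Q f g : ℍ → ℂ} (hP : IsPrimitive P f) (hQ : IsPrimitive Q g) :
    IsPrimitive (P + Q) (f + g) := fun z ↦ (hP z).add (hQ z)

theorem IsPrimitive.sub {P Q f g : ℍ → ℂ} (hP : IsPrimitive P f) (hQ : IsPrimitive Q g) :
    IsPrimitive (P - Q) (f - g) := fun z ↦ (hP z).sub (hQ z)

theorem IsPrimitive.const_smul {P f : ℍ → ℂ} (c : ℂ) (hP : IsPrimitive P f) :
    IsPrimitive (c • P) (c • f) := fun z ↦ (hP z).const_smul c

theorem IsPrimitive.sum {ι : Type*} (s : Finset ι) {P f : ι → ℍ → ℂ}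
    (h : ∀ i ∈ s, IsPrimitive (P i) (f i)) : IsPrimitive (∑ i ∈ s, P i) (∑ i ∈ s, f i) := by
  intro z
  have := HasDerivAt.fun_sum fun i hi ↦ h i hi z
  have e1 : (∑ i ∈ s, P i) ∘ ofComplex = fun y ↦ ∑ i ∈ s, (P i ∘ ofComplex) y := by
    ext w; simp
  rw [e1, Finset.sum_apply]
  exact this

/-- Two primitives of the same function differ by a constant. -/
theorem IsPrimitive.exists_eq_add_const {P Q f : ℍ → ℂ} (hP : IsPrimitive P f)
    (hQ : IsPrimitive Q f) : ∃ c : ℂ, ∀ z, P z = Q z + c := by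
  have hd : ∀ z ∈ upperHalfPlaneSet, HasDerivAt ((P - Q) ∘ ofComplex) 0 z := fun z hz ↦ by
    have := (hP.sub hQ) ⟨z, hz⟩
    simpa using this
  have hopen : IsOpen upperHalfPlaneSet := isOpen_upperHalfPlaneSet
  obtain ⟨c, hc⟩ := hopen.exists_is_const_of_deriv_eq_zero
    (convex_halfSpace_im_gt 0).isPreconnected
    (fun z hz ↦ (hd z hz).differentiableAt.differentiableWithinAt) (fun z hz ↦ (hd z hz).deriv)
  refine ⟨c, fun z ↦ ?_⟩
  have := hc z z.im_pos
  simp at this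
  rw [← this]; ring

/-- The composition of a primitive of `f` with a Möbius transformation is a primitive of the
weight two translate of `f`. -/
theorem IsPrimitive.slash {P f : ℍ → ℂ} (hP : IsPrimitive P f) {g : GL (Fin 2) ℝ}
    (hg : 0 < g.det.val) : IsPrimitive (fun z ↦ P (g • z)) (f ∣[(2 : ℤ)] g) := by
  intro z
  have h1 := (hasStrictDerivAt_smul hg z).hasDerivAt
  have h2 : HasDerivAt (P ∘ ofComplex) (f (g • z)) ((g • ofComplex (z : ℂ) : ℍ) : ℂ) := by
    simpa using hP (g • z)
  have h3 := h2.comp (z : ℂ) h1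
  have e1 : (fun z ↦ P (g • z)) ∘ ofComplex =
      (P ∘ ofComplex) ∘ fun z ↦ ((g • ofComplex z : ℍ) : ℂ) := by
    ext w; simp
  have hσ : σ g = .refl ℝ ℂ := by
    simp only [σ]; rw [if_pos hg]
  -- The derivative of a Möbius map, det / denom², is precisely the weight two factor.
  have e2 : (f ∣[(2 : ℤ)] g) z = f (g • z) * (g.val.det / denom g z ^ 2) := by
    rw [ModularForm.slash_apply, hσ, abs_of_pos hg]
    simp [zpow_neg]
    ring
  rw [e1, e2]
  exact h3

/-- A holomorphic periodic function vanishing at `i∞` has a primitive vanishing at `i∞`. -/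
theorem exists_isPrimitive {f : ℍ → ℂ} {h : ℝ} (hh : 0 < h)
    (hper : Function.Periodic (f ∘ ofComplex) h) (hhol : MDiff f) (hz : IsZeroAtImInfty f) :
    ∃ P : ℍ → ℂ, IsPrimitive P f ∧ Tendsto P atImInfty (𝓝 0) := by
  have hb : IsBoundedAtImInfty f := hz.isBoundedAtImInfty
  have hd := differentiableOn_cuspFunction_ball hh hper hhol hb
  have h0 : cuspFunction h f 0 = 0 := by
    rw [cuspFunction_apply_zero hh (analyticAt_cuspFunction_zero hh hper hhol hb) hper]
    exact hz.valueAtInfty_eq_zero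
  -- With q = exp(2πiz/h), f dz = (h/2πi) (F(q)/q) dq. As F(0) = 0, F(q)/q is holomorphic on the
  -- whole disc and has a primitive there, normalized to vanish at q = 0.
  have hd' : DifferentiableOn ℂ (dslope (cuspFunction h f) 0) (Metric.ball 0 1) :=
    (Complex.differentiableOn_dslope (Metric.ball_mem_nhds 0 one_pos)).mpr hd
  obtain ⟨D, hD0, hD⟩ := hd'.isExactOn_ball.with_val_at 0 0
  refine ⟨fun z ↦ (h / (2 * Real.pi * Complex.I)) * D (Function.Periodic.qParam h z), ?_, ?_⟩
  · intro z
    have hq : ‖Function.Periodic.qParam h z‖ < 1 := Function.Periodic.norm_qParam_lt_one hh z.im_pos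
    have hq0 : Function.Periodic.qParam h z ≠ 0 := Function.Periodic.qParam_ne_zero z
    have h1 : HasDerivAt (Function.Periodic.qParam h)
        (Function.Periodic.qParam h z * (2 * Real.pi * Complex.I / h)) z := by
      have : HasDerivAt (fun w : ℂ ↦ 2 * Real.pi * Complex.I * w / h)
          (2 * Real.pi * Complex.I / h) z := by
        simpa using ((hasDerivAt_id (z : ℂ)).const_mul (2 * Real.pi * Complex.I)).div_const (h : ℂ)
      exact this.cexp
    have h2 := ((hD _ (by simpa using hq)).comp (z : ℂ) h1).const_mul (h / (2 * Real.pi * Complex.I))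
    have h3 : dslope (cuspFunction h f) 0 (Function.Periodic.qParam h z) =
        f z / Function.Periodic.qParam h z := by
      rw [dslope_of_ne _ hq0, slope_def_field, h0, eq_cuspFunction z hh.ne' hper]
      simp
    rw [h3] at h2
    have h4 : (h : ℂ) / (2 * Real.pi * Complex.I) * (f z / Function.Periodic.qParam h z *
        (Function.Periodic.qParam h z * (2 * Real.pi * Complex.I / h))) = f z := by
      have : (h : ℂ) ≠ 0 := by exact_mod_cast hh.ne'
      have : (Real.pi : ℂ) ≠ 0 := by exact_mod_cast Real.pi_ne_zero
      field_simp
    rw [h4] at h2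
    refine h2.congr_of_eventuallyEq ?_
    filter_upwards [isOpen_upperHalfPlaneSet.mem_nhds z.im_pos] with w hw
    simp [ofComplex_apply_of_im_pos hw]
  · have hc : ContinuousAt D 0 := (hD 0 (by simp)).continuousAt
    have := (hc.tendsto.comp (qParam_tendsto_atImInfty hh)).const_mul (h / (2 * Real.pi * Complex.I))
    simpa [hD0] using this

end Primitive

/-! ### Values of a primitive of a cusp form at the cusps -/

section CuspValue

open Filter Topology
open scoped Manifold Pointwise

/-- Γ(N) is normal in SL(2, ℤ) and contained in Γ₁(N), so every conjugate of Γ₁(N) contains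
translation by N. -/
theorem natCast_mem_strictPeriods_conj (N : ℕ) (g : SL(2, ℤ)) :
    (N : ℝ) ∈ (ConjAct.toConjAct (g : GL (Fin 2) ℝ)⁻¹ •
      ((Gamma1 N : Subgroup SL(2, ℤ)) : Subgroup (GL (Fin 2) ℝ))).strictPeriods := by
  have h1 : (N : ℝ) ∈ ((Gamma N : Subgroup SL(2, ℤ)) : Subgroup (GL (Fin 2) ℝ)).strictPeriods := by
    rw [strictPeriods_Gamma]
    exact AddSubgroup.mem_zmultiples _
  rw [Subgroup.mem_strictPeriods_iff] at h1 ⊢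
  obtain ⟨t, ht, hte⟩ := h1
  rw [← hte, map_inv ConjAct.toConjAct, Subgroup.mem_inv_pointwise_smul_iff,
    ConjAct.toConjAct_smul]
  refine ⟨g * t * g⁻¹, ?_, by simp [mul_assoc]; rfl⟩
  have : g * t * g⁻¹ ∈ Gamma N := (Gamma_normal N).conj_mem t ht g
  rw [Gamma_mem] at this
  exact (Gamma1_mem _ _).mpr ⟨this.1, this.2.2.2, this.2.2.1⟩

theorem periodic_slash {N : ℕ} (f : S₂ N) (g : SL(2, ℤ)) :
    Function.Periodic (((f : ℍ → ℂ) ∣[(2 : ℤ)] g) ∘ ofComplex) (N : ℝ) := by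
  have := SlashInvariantFormClass.periodic_comp_ofComplex
    (CuspForm.translate f (g : GL (Fin 2) ℝ)) (natCast_mem_strictPeriods_conj N g)
  simpa using! this

variable {N : ℕ} [NeZero N] (f : S₂ N)

theorem exists_isPrimitive_slash (g : SL(2, ℤ)) :
    ∃ P : ℍ → ℂ, IsPrimitive P ((f : ℍ → ℂ) ∣[(2 : ℤ)] g) ∧ Tendsto P atImInfty (𝓝 0) := by
  refine exists_isPrimitive (h := N) (by exact_mod_cast NeZero.pos N) (periodic_slash f g) ?_
    (CuspFormClass.zero_at_infty_slash f g)
  exact (CuspFormClass.holo f).slash 2 (g : GL (Fin 2) ℝ)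

/-- The value of `P` at the cusp `g ∞`. -/
noncomputable def cuspValue (P : ℍ → ℂ) (g : SL(2, ℤ)) : ℂ := limUnder atImInfty fun z : ℍ ↦ P (g • z)

variable {f} {P : ℍ → ℂ} (hP : IsPrimitive P f)

include hP

/-- The limit exists because P ∘ g is a primitive of f ∣ g, hence differs by a constant from one
that vanishes at i∞. -/
theorem tendsto_cuspValue (g : SL(2, ℤ)) :
    Tendsto (fun z : ℍ ↦ P (g • z)) atImInfty (𝓝 (cuspValue P g)) := by
  obtain ⟨Q, hQ, hQ0⟩ := exists_isPrimitive_slash f g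
  have hPg : IsPrimitive (fun z ↦ P (g • z)) ((f : ℍ → ℂ) ∣[(2 : ℤ)] g) :=
    hP.slash (g := (g : GL (Fin 2) ℝ)) (by simp)
  obtain ⟨c, hc⟩ := hPg.exists_eq_add_const hQ
  have : Tendsto (fun z : ℍ ↦ P (g • z)) atImInfty (𝓝 c) := by
    simp_rw [hc]
    simpa using hQ0.add_const c
  exact tendsto_nhds_limUnder ⟨c, this⟩

theorem tendsto_cuspValue_upper (g : SL(2, ℤ)) {u : GL (Fin 2) ℝ} (hu : u 1 0 = 0) :
    Tendsto (fun z : ℍ ↦ P (g • u • z)) atImInfty (𝓝 (cuspValue P g)) :=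
  (tendsto_cuspValue hP g).comp (tendsto_smul_atImInfty hu)

theorem cuspValue_mul_upper (g u : SL(2, ℤ)) (hu : u 1 0 = 0) :
    cuspValue P (g * u) = cuspValue P g := by
  refine tendsto_nhds_unique (tendsto_cuspValue hP (g * u)) ?_
  have := tendsto_cuspValue_upper hP g (u := (u : GL (Fin 2) ℝ)) (by simp [hu])
  refine this.congr fun z ↦ ?_
  rw [mul_smul]; rfl

/-- P ∘ γ and P are primitives of the same f, so they differ by a constant (a period of f), read off
at the cusp ∞. -/
theorem cuspValue_mul_left {γ : SL(2, ℤ)} (hγ : γ ∈ Gamma1 N) (g : SL(2, ℤ)) :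
    cuspValue P (γ * g) = cuspValue P g + (cuspValue P γ - cuspValue P 1) := by
  have hPg : IsPrimitive (fun z ↦ P (γ • z)) ((f : ℍ → ℂ) ∣[(2 : ℤ)] γ) :=
    hP.slash (g := (γ : GL (Fin 2) ℝ)) (by simp)
  have hinv : (f : ℍ → ℂ) ∣[(2 : ℤ)] γ = f :=
    SlashInvariantFormClass.slash_action_eq f _ ⟨γ, hγ, rfl⟩
  rw [hinv] at hPg
  obtain ⟨c, hc⟩ := hPg.exists_eq_add_const hP
  have key (g : SL(2, ℤ)) : cuspValue P (γ * g) = cuspValue P g + c := by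
    refine tendsto_nhds_unique (tendsto_cuspValue hP (γ * g)) ?_
    simp_rw [mul_smul, hc]
    exact (tendsto_cuspValue hP g).add_const c
  have h1 := key 1
  rw [mul_one] at h1
  rw [key g, h1]; ring

/-- The cusp values of `P` lie in a finitely generated group (Manin's trick). -/
theorem fg_span_cuspValue (h1 : cuspValue P 1 = 0) :
    (Submodule.span ℤ (Set.range (cuspValue P))).FG := by
  -- These are the Manin symbols. The period of γ cancels in the difference, so ψ depends only on
  -- the coset of g modulo Γ₁(N) and takes finitely many values.
  set ψ : SL(2, ℤ) → ℂ := fun g ↦ cuspValue P g - cuspValue P (g * ModularGroup.S) with hψ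
  have hψinv {γ : SL(2, ℤ)} (hγ : γ ∈ Gamma1 N) (g : SL(2, ℤ)) : ψ (γ * g) = ψ g := by
    simp only [hψ]
    rw [mul_assoc, cuspValue_mul_left hP hγ, cuspValue_mul_left hP hγ]; ring
  have hfin : (Set.range ψ).Finite := by
    have : Set.range ψ ⊆ Set.range fun q : SL(2, ℤ) ⧸ Gamma1 N ↦ ψ (Quotient.out q)⁻¹ := by
      rintro _ ⟨g, rfl⟩
      -- The quotient is by cosets gΓ while ψ is invariant on the left, hence the inverse.
      refine ⟨(g⁻¹ : SL(2, ℤ)), ?_⟩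
      obtain ⟨h, hh⟩ := QuotientGroup.mk_out_eq_mul (Gamma1 N) g⁻¹
      have h2 : (Quotient.out ((g⁻¹ : SL(2, ℤ)) : SL(2, ℤ) ⧸ Gamma1 N)) = g⁻¹ * h := hh
      simp only [h2, mul_inv_rev, inv_inv]
      exact hψinv (inv_mem h.2) g
    exact (Set.finite_range _).subset this
  have hψM (g) : ψ g ∈ Submodule.span ℤ (Set.range ψ) := Submodule.subset_span ⟨g, rfl⟩
  have hmem (g : SL(2, ℤ)) : cuspValue P g ∈ Submodule.span ℤ (Set.range ψ) := by
    -- Along a word in S and T, right multiplication by T fixes the cusp ∞ and leaves the value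
    -- unchanged, while S changes it by a Manin symbol.
    have hg : g ∈ Subgroup.closure {ModularGroup.S, ModularGroup.T} := by
      rw [SpecialLinearGroup.SL2Z_generators]; trivial
    induction hg using Subgroup.closure_induction_right with
    | one => rw [h1]; exact zero_mem _
    | mul_right x hx y hy ih =>
      rcases hy with rfl | rfl
      · have : cuspValue P (x * ModularGroup.S) = cuspValue P x - ψ x := by simp [hψ]
        rw [this]; exact sub_mem ih (hψM x)
      · rw [cuspValue_mul_upper hP _ _ (by simp [ModularGroup.T])]; exact ih
    | mul_inv_cancel x hx y hy ih =>
      rcases hy with rfl | rfl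
      · have : cuspValue P (x * ModularGroup.S⁻¹) =
            cuspValue P x + ψ (x * ModularGroup.S⁻¹) := by simp [hψ]
        rw [this]; exact add_mem ih (hψM _)
      · rw [cuspValue_mul_upper hP _ _ (by simp)]; exact ih
  have hle : Submodule.span ℤ (Set.range (cuspValue P)) ≤ Submodule.span ℤ (Set.range ψ) := by
    rw [Submodule.span_le]; rintro _ ⟨g, rfl⟩; exact hmem g
  have hge : Submodule.span ℤ (Set.range ψ) ≤ Submodule.span ℤ (Set.range (cuspValue P)) := by
    rw [Submodule.span_le]; rintro _ ⟨g, rfl⟩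
    exact sub_mem (Submodule.subset_span ⟨_, rfl⟩) (Submodule.subset_span ⟨_, rfl⟩)
  rw [le_antisymm hle hge]
  exact Submodule.fg_span hfin

/-- A cusp form with a primitive vanishing at all cusps is zero. -/
theorem eq_zero_of_cuspValue_eq_zero (h0 : ∀ g, cuspValue P g = 0) : (f : ℍ → ℂ) = 0 := by
  have hinv {γ : SL(2, ℤ)} (hγ : γ ∈ Gamma1 N) (z : ℍ) : P (γ • z) = P z := by
    have hPg : IsPrimitive (fun z ↦ P (γ • z)) ((f : ℍ → ℂ) ∣[(2 : ℤ)] γ) :=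
      hP.slash (g := (γ : GL (Fin 2) ℝ)) (by simp)
    have hinv : (f : ℍ → ℂ) ∣[(2 : ℤ)] γ = f :=
      SlashInvariantFormClass.slash_action_eq f _ ⟨γ, hγ, rfl⟩
    rw [hinv] at hPg
    obtain ⟨c, hc⟩ := hPg.exists_eq_add_const hP
    have h1 := tendsto_cuspValue hP γ
    simp_rw [hc] at h1
    have h2 := (tendsto_cuspValue hP 1).add_const c
    simp only [one_smul] at h2
    have := tendsto_nhds_unique h1 h2
    simp only [h0, zero_add] at this
    rw [hc z, ← this, add_zero]
  -- All periods vanish, so P is Γ₁(N)-invariant; having limits at the cusps, it is a modular form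
  -- of weight zero, hence constant, and f = P' = 0.
  let F : ModularForm ((Gamma1 N : Subgroup SL(2, ℤ)) : Subgroup (GL (Fin 2) ℝ)) 0 :=
    { toFun := P
      slash_action_eq' := by
        rintro _ ⟨γ, hγ, rfl⟩
        ext z
        have := ModularForm.SL_slash_apply (k := 0) (f := P) γ z
        simp only [neg_zero, zpow_zero, mul_one, hinv hγ] at this
        exact this
      holo' := hP.mdifferentiable
      bdd_at_cusps' := by
        intro c hc
        rw [Subgroup.IsArithmetic.isCusp_iff_isCusp_SL2Z] at hc
        rw [OnePoint.isBoundedAt_iff_forall_SL2Z hc]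
        intro γ _
        have h1 := tendsto_cuspValue hP γ
        have h2 : P ∣[(0 : ℤ)] γ = fun z ↦ P (γ • z) := by
          ext z; simp [ModularForm.SL_slash_apply]
        rw [h2]
        exact h1.isBigO_one ℝ }
  obtain ⟨c, hc⟩ := ModularForm.eq_const_of_weight_zero F
  have hPc : P = Function.const ℍ c := hc
  ext z
  have h1 := hP z
  have h2 : P ∘ ofComplex = fun _ ↦ c := by ext; simp [hPc]
  rw [h2] at h1
  exact h1.unique (hasDerivAt_const _ _)

end CuspValue

/-! ### Integrality of Hecke eigenvalues -/

section Hecke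

open Filter Topology

/-- A real matrix with integral first column is the product of an element of `SL(2, ℤ)` and an
upper triangular matrix. -/
theorem exists_SL2_mul_upper (A : GL (Fin 2) ℝ) (a c : ℤ) (ha : A 0 0 = a) (hc : A 1 0 = c) :
    ∃ (g : SL(2, ℤ)) (u : GL (Fin 2) ℝ), A = (g : GL (Fin 2) ℝ) * u ∧ u 1 0 = 0 := by
  have hac : a ≠ 0 ∨ c ≠ 0 := by
    by_contra! h
    have := A.det_ne_zero
    rw [Matrix.det_fin_two, ha, hc, h.1, h.2] at this
    simp at this
  have hd : 0 < Int.gcd a c := Int.gcd_pos_iff.mpr hac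
  obtain ⟨a', c', hcop, ha', hc'⟩ := Int.exists_gcd_one hd
  obtain ⟨x, y, hxy⟩ := Int.isCoprime_iff_gcd_eq_one.mpr hcop
  -- Bézout completes the primitive column (a', c') to a unimodular matrix.
  let g : SL(2, ℤ) := ⟨!![a', -y; c', x], by rw [Matrix.det_fin_two_of]; linarith⟩
  refine ⟨g, (g : GL (Fin 2) ℝ)⁻¹ * A, by simp, ?_⟩
  have h1 : (g : GL (Fin 2) ℝ)⁻¹ = ((g⁻¹ : SL(2, ℤ)) : GL (Fin 2) ℝ) := by simp
  rw [h1]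
  have h10 : (g⁻¹ : SL(2, ℤ)) 1 0 = -c' := by
    rw [Matrix.SpecialLinearGroup.SL2_inv_expl]; simp [g]
  have h11 : (g⁻¹ : SL(2, ℤ)) 1 1 = a' := by
    rw [Matrix.SpecialLinearGroup.SL2_inv_expl]; simp [g]
  have h2 : -c' * a + a' * c = 0 := by linear_combination -c' * ha' + a' * hc'
  have hcoe (γ : SL(2, ℤ)) (i j : Fin 2) : (γ : GL (Fin 2) ℝ) i j = (γ i j : ℝ) := rfl
  simp only [Matrix.GeneralLinearGroup.coe_mul, Matrix.mul_apply, Fin.sum_univ_two, ha, hc, hcoe,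
    h10, h11]
  exact_mod_cast h2

variable {N : ℕ} [NeZero N] {f : S₂ N} {P : ℍ → ℂ}

/-- If the first column of `A * g` is integral, then `P ∘ A` has a cusp value of `P` as its limit at
`g ∞`. -/
theorem exists_tendsto_cuspValue (hP : IsPrimitive P f) (A : GL (Fin 2) ℝ)
    (g : SL(2, ℤ)) (hAg : ∃ a c : ℤ, (A * g) 0 0 = a ∧ (A * g) 1 0 = c) :
    ∃ g' : SL(2, ℤ), Tendsto (fun z : ℍ ↦ P (A • g • z)) atImInfty (𝓝 (cuspValue P g')) := by
  obtain ⟨a, c, ha, hc⟩ := hAg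
  obtain ⟨g', u, hgu, hu⟩ := exists_SL2_mul_upper (A * g) a c ha hc
  refine ⟨g', (tendsto_cuspValue_upper hP g' hu).congr fun z ↦ ?_⟩
  have h1 : A • g • z = (A * g) • z := by rw [mul_smul]; rfl
  rw [h1, hgu, mul_smul]; rfl

theorem upperMatrix_det_pos (p : ℕ) (hp : p ≠ 0) (j : ℕ) : 0 < (upperMatrix p hp j).det.val := by
  simp [upperMatrix, Matrix.det_fin_two]; omega

theorem scaleMatrix_det_pos (d : ℕ) (hd : d ≠ 0) : 0 < (scaleMatrix d hd).det.val := by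
  simp [scaleMatrix, Matrix.det_fin_two]; omega

/-- The action of a Hecke operator on cusp values. -/
theorem exists_eigenvalue_mul_cuspValue (hP : IsPrimitive P f) (hP0 : Tendsto P atImInfty (𝓝 0))
    {ε : DirichletCharacter ℂ N} {p : ℕ} (hp : p ≠ 0) {lam : ℂ}
    (h : heckeT ε p hp f = lam • (f : ℍ → ℂ)) (g : SL(2, ℤ)) :
    ∃ (G : ℕ → SL(2, ℤ)) (G' : SL(2, ℤ)), lam * cuspValue P g =
      ∑ j ∈ Finset.range p, cuspValue P (G j) + ε (p : ZMod N) * cuspValue P G' := by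
  -- The Hecke operator applied to P. Both Q and lam • P are primitives of lam • f vanishing at i∞,
  -- so they coincide and can be compared at every cusp.
  set Q : ℍ → ℂ := (∑ j ∈ Finset.range p, fun z ↦ P (upperMatrix p hp j • z)) +
    ε (p : ZMod N) • (fun z ↦ P (scaleMatrix p hp • z)) with hQdef
  have hQ : IsPrimitive Q (lam • (f : ℍ → ℂ)) := by
    rw [← h]
    exact (IsPrimitive.sum _ fun j _ ↦ hP.slash (upperMatrix_det_pos p hp j)).add
      ((hP.slash (scaleMatrix_det_pos p hp)).const_smul _)
  obtain ⟨c, hc⟩ := hQ.exists_eq_add_const (hP.const_smul lam)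
  have hQ0 : Tendsto Q atImInfty (𝓝 0) := by
    have h1 (j : ℕ) : Tendsto (fun z : ℍ ↦ P (upperMatrix p hp j • z)) atImInfty (𝓝 0) :=
      hP0.comp (tendsto_smul_atImInfty (by simp [upperMatrix]))
    have h2 : Tendsto (fun z : ℍ ↦ P (scaleMatrix p hp • z)) atImInfty (𝓝 0) :=
      hP0.comp (tendsto_smul_atImInfty (by simp [scaleMatrix]))
    have := (tendsto_finsetSum (Finset.range p) fun j _ ↦ h1 j).add (h2.const_mul (ε (p : ZMod N)))
    simp only [Finset.sum_const_zero, mul_zero, add_zero] at this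
    refine this.congr fun z ↦ ?_
    simp [hQdef]
  have hc0 : c = 0 := by
    have h1 : Tendsto Q atImInfty (𝓝 (lam * 0 + c)) := by
      have := (hP0.const_mul lam).add_const c
      refine this.congr fun z ↦ ?_
      rw [hc z]; simp
    simpa using tendsto_nhds_unique h1 hQ0
  have h1 (j : ℕ) := exists_tendsto_cuspValue hP (upperMatrix p hp j) g
    ⟨g 0 0 + j * g 1 0, p * g 1 0, by simp [upperMatrix, Matrix.mul_apply, Fin.sum_univ_two],
      by simp [upperMatrix, Matrix.mul_apply, Fin.sum_univ_two]⟩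
  choose G hG using h1
  obtain ⟨G', hG'⟩ := exists_tendsto_cuspValue hP (scaleMatrix p hp) g
    ⟨p * g 0 0, g 1 0, by simp [scaleMatrix, Matrix.mul_apply, Fin.sum_univ_two],
      by simp [scaleMatrix, Matrix.mul_apply, Fin.sum_univ_two]⟩
  refine ⟨G, G', ?_⟩
  have h2 := (tendsto_finsetSum (Finset.range p) fun j _ ↦ hG j).add
    (hG'.const_mul (ε (p : ZMod N)))
  refine tendsto_nhds_unique ((tendsto_cuspValue hP g).const_mul lam) (h2.congr fun z ↦ ?_)
  have := hc (g • z)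
  rw [hc0, add_zero] at this
  simpa [hQdef] using this

theorem isIntegral_dirichletCharacter (ε : DirichletCharacter ℂ N) (a : ZMod N) :
    IsIntegral ℤ (ε a) := by
  by_cases ha : IsUnit a
  · have : ε a ^ Nat.card (ZMod N)ˣ = 1 := by
      obtain ⟨u, rfl⟩ := ha
      rw [← map_pow, ← Units.val_pow_eq_pow_val, pow_card_eq_one', Units.val_one, map_one]
    exact IsIntegral.of_pow Nat.card_pos (this ▸ isIntegral_one)
  · rw [ε.map_nonunit ha]; exact isIntegral_zero

/-- Hecke eigenvalues of cusp forms of weight two are algebraic integers. -/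
theorem isIntegral_eigenvalue (hf : (f : ℍ → ℂ) ≠ 0) {ε : DirichletCharacter ℂ N} {p : ℕ}
    (hp : p ≠ 0) {lam : ℂ} (h : heckeT ε p hp f = lam • (f : ℍ → ℂ)) : IsIntegral ℤ lam := by
  obtain ⟨P, hP, hP0⟩ := exists_isPrimitive_slash f 1
  rw [SlashAction.slash_one] at hP
  have h1 : cuspValue P 1 = 0 :=
    tendsto_nhds_unique (tendsto_cuspValue hP 1) (by simpa using hP0)
  set M : Submodule ℤ ℂ := Submodule.span ℤ (Set.range (cuspValue P)) with hM
  set E : Submodule ℤ ℂ := Submodule.span ℤ (Set.range ε) with hE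
  have hMmem (g) : cuspValue P g ∈ M := Submodule.subset_span ⟨g, rfl⟩
  have hEmem (a) : ε a ∈ E := Submodule.subset_span ⟨a, rfl⟩
  have hE1 : (1 : ℂ) ∈ E := by simpa using hEmem 1
  have hEmul (a) {x : ℂ} (hx : x ∈ E) : ε a * x ∈ E := by
    induction hx using Submodule.span_induction with
    | mem x hx => obtain ⟨b, rfl⟩ := hx; rw [← map_mul]; exact hEmem _
    | zero => simp
    | add x y _ _ hx hy => rw [mul_add]; exact add_mem hx hy
    | smul n x _ hx => rw [mul_smul_comm]; exact Submodule.smul_mem _ n hx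
  -- Adjoining the character values makes the module stable under the factor ε(p) in the Hecke
  -- operator.
  have hfg : (E * M).FG :=
    (Submodule.fg_span (Set.finite_range ε)).mul (fg_span_cuspValue hP h1)
  refine isIntegral_of_smul_mem_submodule (E * M) ?_ hfg lam ?_
  · intro hbot
    refine hf (eq_zero_of_cuspValue_eq_zero hP fun g ↦ ?_)
    have := Submodule.mul_mem_mul hE1 (hMmem g)
    rw [hbot] at this
    simpa using this
  · have key {m : ℂ} (hm : m ∈ M) : ∀ e ∈ E, lam * (e * m) ∈ E * M := by
      induction hm using Submodule.span_induction with
      | mem x hx =>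
        obtain ⟨g, rfl⟩ := hx
        intro e he
        obtain ⟨G, G', hG⟩ := exists_eigenvalue_mul_cuspValue hP hP0 hp h g
        rw [mul_left_comm, hG, mul_add, Finset.mul_sum, ← mul_assoc, mul_comm e]
        exact add_mem (sum_mem fun j _ ↦ Submodule.mul_mem_mul he (hMmem _))
          (Submodule.mul_mem_mul (hEmul _ he) (hMmem _))
      | zero => simp
      | add x y _ _ hx hy =>
        intro e he; rw [mul_add, mul_add]; exact add_mem (hx e he) (hy e he)
      | smul n x _ hx =>
        intro e he
        rw [mul_smul_comm, mul_smul_comm]; exact Submodule.smul_mem _ n (hx e he)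
    intro x hx
    induction hx using Submodule.mul_induction_on' with
    | mem_mul_mem e he m hm => exact key hm e he
    | add x _ y _ hx hy => rw [smul_add]; exact add_mem hx hy

end Hecke

/-! ### Integrality of Fourier coefficients -/

section Fourier

open Function.Periodic

theorem upperMatrix_smul_coe (p : ℕ) (hp : p ≠ 0) (j : ℕ) (z : ℍ) :
    ((upperMatrix p hp j • z : ℍ) : ℂ) = (z + j) / p := by
  rw [coe_smul_of_det_pos (upperMatrix_det_pos p hp j)]
  simp [upperMatrix, num, denom]

theorem scaleMatrix_smul_coe (d : ℕ) (hd : d ≠ 0) (z : ℍ) :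
    ((scaleMatrix d hd • z : ℍ) : ℂ) = d * z := by
  rw [coe_smul_of_det_pos (scaleMatrix_det_pos d hd)]
  simp [scaleMatrix, num, denom]

theorem slash_upperMatrix (f : ℍ → ℂ) (p : ℕ) (hp : p ≠ 0) (j : ℕ) (z : ℍ) :
    (f ∣[(2 : ℤ)] upperMatrix p hp j) z = (p : ℂ)⁻¹ * f (upperMatrix p hp j • z) := by
  have hσ : σ (upperMatrix p hp j) = .refl ℝ ℂ := by
    simp only [σ]; rw [if_pos (upperMatrix_det_pos p hp j)]
  have hp' : (p : ℂ) ≠ 0 := by exact_mod_cast hp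
  rw [ModularForm.slash_apply, hσ, abs_of_pos (upperMatrix_det_pos p hp j)]
  simp [upperMatrix, denom, Matrix.det_fin_two, zpow_neg]
  norm_cast
  field_simp
  push_cast
  ring

theorem slash_scaleMatrix (f : ℍ → ℂ) (d : ℕ) (hd : d ≠ 0) (z : ℍ) :
    (f ∣[(2 : ℤ)] scaleMatrix d hd) z = d * f (scaleMatrix d hd • z) := by
  have hσ : σ (scaleMatrix d hd) = .refl ℝ ℂ := by
    simp only [σ]; rw [if_pos (scaleMatrix_det_pos d hd)]
  rw [ModularForm.slash_apply, hσ, abs_of_pos (scaleMatrix_det_pos d hd)]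
  simp [scaleMatrix, denom, Matrix.det_fin_two, mul_comm]

theorem qParam_one_add_div (p : ℕ) (z : ℂ) (j : ℕ) :
    qParam 1 ((z + j) / p) = qParam 1 (z / p) * Complex.exp (2 * Real.pi * Complex.I / p) ^ j := by
  simp only [qParam]
  rw [← Complex.exp_nat_mul, ← Complex.exp_add]
  congr 1
  push_cast; ring

/-- Orthogonality of the p-th roots of unity: averaging over j keeps only the exponents divisible by
p. -/
theorem sum_qParam_pow {p : ℕ} (hp : p ≠ 0) (z : ℂ) (n : ℕ) :
    (p : ℂ)⁻¹ * ∑ j ∈ Finset.range p, qParam 1 ((z + j) / p) ^ n =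
      if p ∣ n then qParam 1 z ^ (n / p) else 0 := by
  have hp' : (p : ℂ) ≠ 0 := by exact_mod_cast hp
  set ζ := Complex.exp (2 * Real.pi * Complex.I / p) with hζ
  have hprim : IsPrimitiveRoot ζ p := Complex.isPrimitiveRoot_exp p hp
  have h1 : ∑ j ∈ Finset.range p, qParam 1 ((z + j) / p) ^ n =
      qParam 1 (z / p) ^ n * ∑ j ∈ Finset.range p, (ζ ^ n) ^ j := by
    rw [Finset.mul_sum]
    refine Finset.sum_congr rfl fun j _ ↦ ?_
    rw [qParam_one_add_div, mul_pow, ← pow_mul, ← pow_mul, mul_comm j n]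
  rw [h1]
  split_ifs with h
  · rw [(hprim.pow_eq_one_iff_dvd n).mpr h]
    obtain ⟨k, rfl⟩ := h
    simp only [one_pow, Finset.sum_const, Finset.card_range, nsmul_eq_mul, mul_one]
    rw [Nat.mul_div_cancel_left k (Nat.pos_of_ne_zero hp), mul_comm, mul_assoc, mul_inv_cancel₀ hp',
      mul_one, pow_mul]
    congr 1
    simp only [qParam]
    rw [← Complex.exp_nat_mul]
    congr 1
    push_cast
    field_simp
  · have hne : ζ ^ n ≠ 1 := fun h' ↦ h ((hprim.pow_eq_one_iff_dvd n).mp h')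
    rw [geom_sum_eq hne, ← pow_mul, mul_comm n p, pow_mul, hprim.pow_eq_one, one_pow]
    simp

theorem qParam_one_natCast_mul (d : ℕ) (z : ℂ) : qParam 1 (d * z) = qParam 1 z ^ d := by
  simp only [qParam]
  rw [← Complex.exp_nat_mul]
  congr 1
  ring

variable {N : ℕ} [NeZero N] {f : S₂ N}

theorem one_mem_strictPeriods_Gamma1 (N : ℕ) :
    (1 : ℝ) ∈ ((Gamma1 N : Subgroup SL(2, ℤ)) : Subgroup (GL (Fin 2) ℝ)).strictPeriods := by
  rw [strictPeriods_Gamma1]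
  exact AddSubgroup.mem_zmultiples _

theorem hasSum_fourier (f : S₂ N) (z : ℍ) :
    HasSum (fun n ↦ (qExpansion 1 (f : ℍ → ℂ)).coeff n * qParam 1 z ^ n) (f z) :=
  ModularForm.hasSum_qExpansion f one_pos (one_mem_strictPeriods_Gamma1 N) z

/-- The action of a Hecke operator on Fourier coefficients. -/
theorem eigenvalue_mul_coeff {ε : DirichletCharacter ℂ N} {p : ℕ} (hp : p ≠ 0) {lam : ℂ}
    (h : heckeT ε p hp f = lam • (f : ℍ → ℂ)) (n : ℕ) :
    lam * (qExpansion 1 (f : ℍ → ℂ)).coeff n = (qExpansion 1 (f : ℍ → ℂ)).coeff (p * n) +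
      ε (p : ZMod N) *
        (p * if p ∣ n then (qExpansion 1 (f : ℍ → ℂ)).coeff (n / p) else 0) := by
  set a : ℕ → ℂ := fun n ↦ (qExpansion 1 (f : ℍ → ℂ)).coeff n with ha
  have hpos := Nat.pos_of_ne_zero hp
  have hinj : Function.Injective fun m : ℕ ↦ p * m := fun x y hxy ↦
    Nat.eq_of_mul_eq_mul_left hpos hxy
  have hsum (z : ℍ) := hasSum_fourier f z
  have hU (z : ℍ) : HasSum (fun n ↦ a (p * n) * qParam 1 z ^ n)
      ((∑ j ∈ Finset.range p, (f : ℍ → ℂ) ∣[(2 : ℤ)] upperMatrix p hp j) z) := by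
    have h1 := (hasSum_sum fun j (_ : j ∈ Finset.range p) ↦
      hsum (upperMatrix p hp j • z)).mul_left (p : ℂ)⁻¹
    have h2 : (fun n ↦ (p : ℂ)⁻¹ * ∑ j ∈ Finset.range p,
        a n * qParam 1 ((upperMatrix p hp j • z : ℍ) : ℂ) ^ n) =
        fun n ↦ if p ∣ n then a n * qParam 1 z ^ (n / p) else 0 := by
      ext n
      rw [← Finset.mul_sum, mul_left_comm]
      simp_rw [upperMatrix_smul_coe]
      rw [sum_qParam_pow hp, mul_ite, mul_zero]
    rw [h2, ← hinj.hasSum_iff] at h1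
    · rw [Finset.sum_apply]
      simp_rw [slash_upperMatrix, ← Finset.mul_sum]
      refine h1.congr_fun ?_
      intro n
      simp [Nat.mul_div_cancel_left n hpos]
    · intro x hx
      rw [if_neg]
      rintro ⟨k, rfl⟩
      exact hx ⟨k, rfl⟩
  have hV (z : ℍ) : HasSum (fun n ↦ (p * if p ∣ n then a (n / p) else 0) * qParam 1 z ^ n)
      (((f : ℍ → ℂ) ∣[(2 : ℤ)] scaleMatrix p hp) z) := by
    rw [slash_scaleMatrix]
    have h1 := (hsum (scaleMatrix p hp • z)).mul_left (p : ℂ)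
    rw [← hinj.hasSum_iff]
    · refine h1.congr_fun ?_
      intro n
      simp [Nat.mul_div_cancel_left n hpos, scaleMatrix_smul_coe, qParam_one_natCast_mul, pow_mul,
        mul_assoc, ha]
    · intro x hx
      rw [if_neg]
      · simp
      rintro ⟨k, rfl⟩
      exact hx ⟨k, rfl⟩
  have h1 (z : ℍ) : HasSum (fun n ↦ (a (p * n) + ε (p : ZMod N) *
      (p * if p ∣ n then a (n / p) else 0)) • qParam 1 z ^ n) ((lam • f : S₂ N) z) := by
    have h3 := (hU z).add ((hV z).mul_left (ε (p : ZMod N)))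
    have h4 : (lam • f : S₂ N) z = heckeT ε p hp f z := by rw [h]; rfl
    rw [h4]
    refine h3.congr_fun fun n ↦ ?_
    rw [smul_eq_mul]; ring
  have h2 (z : ℍ) : HasSum (fun n ↦ (lam * a n) • qParam 1 z ^ n) ((lam • f : S₂ N) z) := by
    refine ((hsum z).mul_left lam).congr_fun fun n ↦ ?_
    rw [smul_eq_mul]; ring
  exact (ModularFormClass.qExpansion_coeff_unique one_pos (one_mem_strictPeriods_Gamma1 N) h2
    n).trans (ModularFormClass.qExpansion_coeff_unique one_pos (one_mem_strictPeriods_Gamma1 N)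
    h1 n).symm

/-- The Fourier coefficients of a newform are algebraic integers. -/
theorem IsNewform.isIntegral_coeff {ε : DirichletCharacter ℂ N} (hf : IsNewform ε f) (n : ℕ) :
    IsIntegral ℤ ((qExpansion 1 (f : ℍ → ℂ)).coeff n) := by
  have hf0 : (f : ℍ → ℂ) ≠ 0 := by
    intro h0
    have := hf.normalized
    rw [h0, qExpansion_zero] at this
    simp at this
  induction n using Nat.strong_induction_on with
  | _ n ih =>
    rcases Nat.lt_or_ge n 2 with hn | hn
    · interval_cases n
      · have : (qExpansion 1 (f : ℍ → ℂ)).coeff 0 = 0 :=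
          CuspFormClass.qExpansion_coeff_zero f one_pos (one_mem_strictPeriods_Gamma1 N)
        rw [this]; exact isIntegral_zero
      · rw [hf.normalized]; exact isIntegral_one
    -- For n = pk the Hecke relation reads a_n = lam a_k - ε(p) p a_{k/p}, with smaller indices on
    -- the right.
    · have hp : n.minFac.Prime := Nat.minFac_prime (by omega)
      obtain ⟨k, hk⟩ := n.minFac_dvd
      set p := n.minFac
      obtain ⟨lam, hlam⟩ := hf.eigen p hp
      have hkpos : 0 < k := Nat.pos_of_ne_zero (by rintro rfl; omega)
      have hkn : k < n := by
        rw [hk]; exact lt_mul_of_one_lt_left hkpos hp.one_lt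
      have h1 := eigenvalue_mul_coeff hp.ne_zero hlam k
      rw [hk, ← sub_eq_iff_eq_add.mpr h1]
      refine ((isIntegral_eigenvalue hf0 hp.ne_zero hlam).mul (ih k hkn)).sub
        ((isIntegral_dirichletCharacter ε _).mul (IsIntegral.mul ?_ ?_))
      · exact_mod_cast isIntegral_algebraMap (R := ℤ) (A := ℂ) (x := (p : ℤ))
      · split_ifs
        · exact ih _ ((Nat.div_le_self k p).trans_lt hkn)
        · exact isIntegral_zero

end Fourier

/-! ### Quadratic fields -/

section Quadratic

theorem exists_eq_add_mul_of_mem_adjoin {s : ℂ} {m : ℤ} (hs : s ^ 2 = m) {z : ℂ}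
    (hz : z ∈ IntermediateField.adjoin ℚ {s}) : ∃ x y : ℚ, z = x + y * s := by
  have halg : IsAlgebraic ℚ s := by
    refine IsIntegral.isAlgebraic (IsIntegral.of_pow two_pos ?_)
    rw [hs]
    exact_mod_cast isIntegral_algebraMap (R := ℚ) (A := ℂ) (x := (m : ℚ))
  rw [← IntermediateField.mem_toSubalgebra,
    IntermediateField.adjoin_simple_toSubalgebra_of_isAlgebraic halg] at hz
  induction hz using Algebra.adjoin_induction with
  | mem x hx => exact ⟨0, 1, by rw [Set.mem_singleton_iff.mp hx]; simp⟩
  | algebraMap r => exact ⟨r, 0, by simp⟩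
  | add _ _ _ _ h1 h2 =>
    obtain ⟨x, y, rfl⟩ := h1
    obtain ⟨x', y', rfl⟩ := h2
    exact ⟨x + x', y + y', by push_cast; ring⟩
  | mul _ _ _ _ h1 h2 =>
    obtain ⟨x, y, rfl⟩ := h1
    obtain ⟨x', y', rfl⟩ := h2
    exact ⟨x * x' + m * y * y', x * y' + y * x', by
      push_cast; linear_combination (y : ℂ) * y' * hs⟩

/-- The nontrivial automorphism of a quadratic field `ℚ(s)` maps `x + y s` to `x - y s`. -/
theorem exists_coordinates {L : IntermediateField ℚ ℂ} {s : ℂ} {m : ℤ} (hs : s ^ 2 = m)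
    (hL : L = IntermediateField.adjoin ℚ {s}) (σ : Gal(L/ℚ)) (hσ : σ ≠ 1) (a : L) :
    ∃ x y : ℚ, (a : ℂ) = x + y * s ∧ ((σ a : L) : ℂ) = x - y * s := by
  have hsL : s ∈ L := hL ▸ IntermediateField.mem_adjoin_simple_self ℚ s
  set S : L := ⟨s, hsL⟩ with hS
  have hcoord (b : L) : ∃ x y : ℚ, b = (x : L) + (y : L) * S := by
    obtain ⟨x, y, h⟩ := exists_eq_add_mul_of_mem_adjoin hs (hL ▸ b.2 : (b : ℂ) ∈ _)
    exact ⟨x, y, Subtype.ext (by simpa [hS] using h)⟩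
  have hS2 : S ^ 2 = (m : L) := Subtype.ext (by simpa [hS] using hs)
  have hσS : σ S = -S := by
    have h1 : (σ S) ^ 2 = S ^ 2 := by rw [← map_pow, hS2, map_intCast]
    rcases sq_eq_sq_iff_eq_or_eq_neg.mp h1 with h | h
    · refine absurd (AlgEquiv.ext fun b ↦ ?_) hσ
      obtain ⟨x, y, rfl⟩ := hcoord b
      simp [h]
    · exact h
  obtain ⟨x, y, h⟩ := hcoord a
  refine ⟨x, y, by rw [h]; simp [hS], ?_⟩
  have h1 : σ a = (x : L) - (y : L) * S := by rw [h]; simp [hσS, sub_eq_add_neg]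
  rw [h1]
  simp [hS]

theorem exists_int_of_isIntegral_ratCast {r : ℚ} (h : IsIntegral ℤ (r : ℂ)) : ∃ k : ℤ, r = k := by
  obtain ⟨k, hk⟩ := h.exists_int_iff_exists_rat.mp ⟨r, rfl⟩
  exact ⟨k, by exact_mod_cast hk⟩

/-- The square of the denominator of r is coprime to that of the numerator, so it divides m. -/
theorem exists_int_of_squarefree_mul_sq {m : ℤ} (hm : Squarefree m) {r : ℚ} {k : ℤ}
    (h : m * r ^ 2 = k) : ∃ l : ℤ, r = l := by
  have hden : (r.den : ℚ) ≠ 0 := by exact_mod_cast r.den_nz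
  have h1 : m * r.num ^ 2 = k * (r.den : ℤ) ^ 2 := by
    have h2 := h
    rw [← Rat.num_div_den r] at h2
    field_simp at h2
    rw [mul_comm k]
    exact_mod_cast h2
  have hcop : IsCoprime ((r.den : ℤ) ^ 2) (r.num ^ 2) := by
    refine IsCoprime.pow (Int.isCoprime_iff_gcd_eq_one.mpr ?_)
    have := r.reduced
    rw [Int.gcd_comm]
    simpa [Int.gcd, Nat.Coprime] using this
  have h2 : (r.den : ℤ) ^ 2 ∣ m := hcop.dvd_of_dvd_mul_right (Dvd.intro_left _ h1.symm)
  have h3 : IsUnit (r.den : ℤ) := hm _ (by rw [← sq]; exact h2)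
  have h4 : r.den = 1 := by simpa using Int.isUnit_iff_natAbs_eq.mp h3
  exact ⟨r.num, by rw [← Rat.coe_int_num_of_den_eq_one h4]; simp⟩

/-- The coordinates of the integers of the quadratic field `ℚ(√m)`. -/
theorem exists_int_coordinates {m : ℤ} (hm : Squarefree m) {s : ℂ} (hs : s ^ 2 = m) {x y : ℚ}
    (h1 : IsIntegral ℤ (x + y * s : ℂ)) (h2 : IsIntegral ℤ (x - y * s : ℂ)) :
    ∃ X Y : ℤ, 2 * x = X ∧ 2 * y = Y ∧ 4 ∣ X ^ 2 - m * Y ^ 2 := by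
  -- The trace is 2x and the norm is k = x² - my²; then m(2y)² = X² - 4k forces 2y to be an integer.
  obtain ⟨X, hX⟩ := exists_int_of_isIntegral_ratCast (r := 2 * x) (by
    have := h1.add h2
    have e : (x + y * s + (x - y * s) : ℂ) = ((2 * x : ℚ) : ℂ) := by push_cast; ring
    rwa [e] at this)
  obtain ⟨k, hk⟩ := exists_int_of_isIntegral_ratCast (r := x ^ 2 - m * y ^ 2) (by
    have := h1.mul h2
    have e : ((x + y * s) * (x - y * s) : ℂ) = ((x ^ 2 - m * y ^ 2 : ℚ) : ℂ) := by
      push_cast; linear_combination -(y : ℂ) ^ 2 * hs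
    rwa [e] at this)
  obtain ⟨Y, hY⟩ := exists_int_of_squarefree_mul_sq hm (r := 2 * y) (k := X ^ 2 - 4 * k) (by
    push_cast; rw [← hX, ← hk]; ring)
  refine ⟨X, Y, hX, hY, k, ?_⟩
  have : ((X ^ 2 - m * Y ^ 2 : ℤ) : ℚ) = ((4 * k : ℤ) : ℚ) := by
    push_cast; rw [← hX, ← hY, ← hk]; ring
  exact_mod_cast this

/-- Squares are 0 or 1 modulo 4, so an odd X or Y would require m ≡ 0 or 1. -/
theorem even_of_four_dvd {m X Y : ℤ} (hm : m ≡ 2 [ZMOD 4] ∨ m ≡ 3 [ZMOD 4])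
    (h : 4 ∣ X ^ 2 - m * Y ^ 2) : 2 ∣ X ∧ 2 ∣ Y := by
  have h1 : (X ^ 2 - m * Y ^ 2) ≡ 0 [ZMOD 4] := (Int.modEq_zero_iff_dvd).mpr h
  have hres (Z : ℤ) : Z ≡ 0 [ZMOD 4] ∨ Z ≡ 1 [ZMOD 4] ∨ Z ≡ 2 [ZMOD 4] ∨ Z ≡ 3 [ZMOD 4] := by
    simp only [Int.ModEq]; omega
  have key : ∀ u v w : ℤ, m ≡ u [ZMOD 4] → X ≡ v [ZMOD 4] → Y ≡ w [ZMOD 4] →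
      v ^ 2 - u * w ^ 2 ≡ 0 [ZMOD 4] := fun u v w hu hv hw ↦
    (((hv.pow 2).sub (hu.mul (hw.pow 2))).symm).trans h1
  rcases hm with hm | hm <;> rcases hres X with hX | hX | hX | hX <;>
    rcases hres Y with hY | hY | hY | hY <;>
    first
    | (simp only [Int.ModEq] at hX hY; constructor <;> omega)
    | (exfalso; have := key _ _ _ hm hX hY; revert this; decide)

variable {K : Type*} [Field K]

/-- A nonrational element of a quadratic field has a conjugate. -/
theorem exists_conjugate [NumberField K] (hK : Module.finrank ℚ K = 2) {α : K} {m : ℤ} (hm : ¬ IsSquare m)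
    (hα : Algebra.norm ℚ α = m) : ∃ τ : K ≃ₐ[ℚ] K, α * τ α = m ∧ τ α ≠ α := by
  have : Algebra.IsQuadraticExtension ℚ K := ⟨hK⟩
  have hnorm := Algebra.norm_eq_prod_automorphisms ℚ α
  have hcard : Nat.card Gal(K/ℚ) = 2 := by rw [IsGalois.card_aut_eq_finrank, hK]
  have hne : ∃ τ : Gal(K/ℚ), τ ≠ 1 := by
    have : Nontrivial Gal(K/ℚ) := Finite.one_lt_card_iff_nontrivial.mp (by omega)
    exact exists_ne 1
  obtain ⟨τ, hτ⟩ := hne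
  classical
  have huniv : (Finset.univ : Finset Gal(K/ℚ)) = {1, τ} := by
    symm
    refine Finset.eq_univ_of_card _ ?_
    rw [Finset.card_pair hτ.symm, ← Nat.card_eq_fintype_card, hcard]
  rw [huniv, Finset.prod_pair hτ.symm, hα] at hnorm
  have h1 : α * τ α = m := by simpa using hnorm.symm
  -- If τ fixed α, then α would be rational and m = α² a square.
  refine ⟨τ, h1, fun h ↦ hm ?_⟩
  have hbot : α ∈ (⊥ : IntermediateField ℚ K) := by
    rw [IsGalois.mem_bot_iff_fixed]
    intro g
    have : g ∈ (Finset.univ : Finset Gal(K/ℚ)) := Finset.mem_univ g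
    rw [huniv] at this
    rcases Finset.mem_insert.mp this with rfl | hg
    · rfl
    · rw [Finset.mem_singleton.mp hg, h]
  obtain ⟨r, rfl⟩ := IntermediateField.mem_bot.mp hbot
  rw [h] at h1
  rw [← Rat.isSquare_intCast_iff]
  refine ⟨r, (algebraMap ℚ K).injective ?_⟩
  rw [map_mul, h1, map_intCast]

/-- The denominator ideals of conjugate elements have the same norm. -/
theorem absNorm_elementDenominator_conj [NumberField K] (τ : K ≃ₐ[ℚ] K) (α : K) :
    Ideal.absNorm (elementDenominator (τ α)) = Ideal.absNorm (elementDenominator α) := by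
  let e : 𝓞 K ≃+* 𝓞 K := NumberField.RingOfIntegers.mapRingEquiv τ.toRingEquiv
  have he (x : 𝓞 K) : ((e x : 𝓞 K) : K) = τ x := rfl
  have hes (x : 𝓞 K) : ((e.symm x : 𝓞 K) : K) = τ.symm x := rfl
  -- τ restricts to an automorphism of `𝓞 K` carrying one ideal onto the other.
  have hmap : elementDenominator (τ α) = Ideal.map (e : 𝓞 K →+* 𝓞 K) (elementDenominator α) := by
    refine le_antisymm ?_ ?_
    · rintro x ⟨y, hy⟩
      have hx : x = (e : 𝓞 K →+* 𝓞 K) (e.symm x) := by simp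
      rw [hx]
      refine Ideal.mem_map_of_mem _ ⟨e.symm y, ?_⟩
      rw [hes, hes, ← hy, map_mul, AlgEquiv.symm_apply_apply]
    · rw [Ideal.map_le_iff_le_comap]
      rintro x ⟨y, hy⟩
      refine ⟨e y, ?_⟩
      change ((e x : 𝓞 K) : K) * τ α = _
      rw [he, he, ← map_mul, hy]
  rw [Ideal.absNorm_apply, Ideal.absNorm_apply, Submodule.cardQuot_apply, Submodule.cardQuot_apply]
  exact (Nat.card_congr (Ideal.quotientEquiv _ _ e hmap).toEquiv).symm

theorem mem_elementDenominator {α : K} {x : 𝓞 K} :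
    x ∈ elementDenominator α ↔ IsIntegral ℤ ((x : K) * α) :=
  ⟨fun ⟨y, hy⟩ ↦ hy ▸ NumberField.RingOfIntegers.isIntegral_coe y, fun h ↦ ⟨⟨_, h⟩, rfl⟩⟩

theorem elementDenominator_eq_top {α : K} (hα : IsIntegral ℤ α) : elementDenominator α = ⊤ := by
  rw [Ideal.eq_top_iff_one, mem_elementDenominator]
  simpa using hα

theorem mem_seriesDenominator {ι : K →+* ℂ} {h : ℂ⟦X⟧} {b : ℕ → K} (hb : ∀ n, h.coeff n = ι (b n))
    {x : K} : x ∈ seriesDenominator ι h ↔ ∀ n, IsIntegral ℤ (x * b n) := by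
  constructor
  · rintro ⟨g, hg⟩ n
    have := congrArg (PowerSeries.coeff n) hg
    rw [PowerSeries.coeff_C_mul, PowerSeries.coeff_map, hb, ← map_mul] at this
    rw [ι.injective this]
    exact NumberField.RingOfIntegers.isIntegral_coe _
  · intro hx
    have hy (n : ℕ) : ∃ y : 𝓞 K, (y : K) = x * b n := ⟨⟨_, hx n⟩, rfl⟩
    choose y hy using hy
    refine ⟨PowerSeries.mk y, ?_⟩
    ext n
    rw [PowerSeries.coeff_C_mul, PowerSeries.coeff_map, hb, ← map_mul, PowerSeries.coeff_mk, ← hy]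
    rfl

end Quadratic

/-- The coefficients of `(f + κ σ(f)) / (1 + κ)` in terms of those of `f`. -/
theorem normalization_identity {p q δ s m κ : ℂ} (hs : s ^ 2 = m)
    (hm : (p + q * δ) * (p - q * δ) = m) (hm0 : m ≠ 0) (hqδ : q * δ ≠ 0) (hps : p + s ≠ 0)
    (hκ : κ = δ / (p / q + 1 / q * s)) (x y : ℂ) :
    1 / (1 + κ) * ((x + y * s) + κ * (x - y * s)) = x + y * (p - q * δ) := by
  have hq : q ≠ 0 := left_ne_zero_of_mul hqδ
  have hκ' : κ = q * δ / (p + s) := by rw [hκ]; field_simp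
  -- Otherwise (p + qδ)² = s² = (p + qδ)(p - qδ), so qδ = 0.
  have hAs : p + q * δ + s ≠ 0 := by
    intro h
    have hA0 : p + q * δ ≠ 0 := fun h0 ↦ hm0 (by rw [← hm, h0, zero_mul])
    have h1 : (p + q * δ) * (p - q * δ) = (p + q * δ) * (p + q * δ) := by
      rw [hm, ← hs]; linear_combination (s - (p + q * δ)) * h
    have h2 := mul_left_cancel₀ hA0 h1
    exact hqδ (by linear_combination -h2 / 2)
  have h1κ : 1 + κ = (p + q * δ + s) / (p + s) := by rw [hκ']; field_simp; ring
  have h1κ' : 1 + κ ≠ 0 := by rw [h1κ]; exact div_ne_zero hAs hps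
  rw [one_div, inv_mul_eq_iff_eq_mul₀ h1κ', h1κ, hκ']
  field_simp
  linear_combination y * hs - y * hm

/-! ### Comparison of denominator ideals -/

section Denominator

variable {K : Type*} [Field K]

theorem absNorm_span_two [NumberField K] (hK : Module.finrank ℚ K = 2) :
    Ideal.absNorm (Ideal.span {(2 : 𝓞 K)}) = 4 := by
  have h1 : (2 : 𝓞 K) = algebraMap ℤ (𝓞 K) 2 := by simp
  rw [Ideal.absNorm_span_singleton, h1, Algebra.norm_algebraMap, NumberField.RingOfIntegers.rank,
    hK]
  rfl

/-- An ideal containing the common denominators of the elements `x n + y n * α`, where `x n` and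
`y n` are integers, contains the denominator ideal of `α`. -/
theorem elementDenominator_le {D : Ideal (𝓞 K)} {α : K} {x y : ℕ → ℤ}
    (hD : ∀ d : 𝓞 K, (∀ n, IsIntegral ℤ ((d : K) * (x n + y n * α))) → d ∈ D) :
    elementDenominator α ≤ D := by
  intro d hd
  rw [mem_elementDenominator] at hd
  refine hD d fun n ↦ ?_
  have e : (d : K) * (x n + y n * α) = (x n : K) * d + (y n : K) * (d * α) := by ring
  rw [e]
  have hint (k : ℤ) : IsIntegral ℤ (k : K) := by
    simpa using isIntegral_algebraMap (R := ℤ) (A := K) (x := k)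
  exact ((hint _).mul (NumberField.RingOfIntegers.isIntegral_coe d)).add ((hint _).mul hd)

end Denominator

end QCurve

/-! ### The main theorem -/

theorem mainTheorem6 {K : Type*} [Field K] [NumberField K]
    (hK : Module.finrank ℚ K = 2) (ι : K →+* ℂ)
    (sqrtΔ : ℂ) (hΔ : sqrtΔ ^ 2 = (NumberField.discr K : ℂ))
    (m : ℤ) (hm : Squarefree m) (hm' : ¬ IsSquare m)
    (sqrtm : ℂ) (hsqrtm : sqrtm ^ 2 = (m : ℂ))
    (N : ℕ) [NeZero N] (ε : DirichletCharacter ℂ N) (f : QCurve.S₂ N)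
    (hf : QCurve.IsNewform ε f)
    (hF : QCurve.coeffField f = IntermediateField.adjoin ℚ {sqrtm})
    (σ : Gal(QCurve.coeffField f/ℚ)) (hσ : σ ≠ 1)
    (α : K) (hα : Algebra.norm ℚ α = (m : ℚ))
    (p q : ℚ) (hpq : ι α = (p : ℂ) + (q : ℂ) * sqrtΔ)
    (β κ : ℂ) (hβ : β = (p : ℂ) / (q : ℂ) + 1 / (q : ℂ) * sqrtm) (hκ : κ = sqrtΔ / β)
    (h : PowerSeries ℂ) (hh : h = QCurve.hExpansion f σ κ) :
    ∃ D : Ideal (𝓞 K),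
      (∀ x : K, x ∈ QCurve.seriesDenominator ι h ↔ ∃ d ∈ D, (d : K) = x) ∧
      ((m ≡ 2 [ZMOD 4] ∨ m ≡ 3 [ZMOD 4]) →
        Ideal.absNorm D ∣ Ideal.absNorm (QCurve.elementDenominator α)) ∧
      (m ≡ 1 [ZMOD 4] →
        Ideal.absNorm D ∣ 4 * Ideal.absNorm (QCurve.elementDenominator α)) ∧
      (IsIntegral ℤ α →
        ((m ≡ 2 [ZMOD 4] ∨ m ≡ 3 [ZMOD 4]) → Ideal.absNorm D = 1) ∧
        (m ≡ 1 [ZMOD 4] → Ideal.absNorm D ∈ ({1, 2, 4} : Set ℕ))) := by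
  obtain ⟨τ, hτ, hτα⟩ := QCurve.exists_conjugate hK hm' hα
  have hm0 : m ≠ 0 := hm.ne_zero
  -- Squaring avoids having to locate √Δ in `K`: τ fixes (α - p)², so τ α - p = ±(α - p), and the
  -- sign is minus.
  have hsq : (α - p) ^ 2 = (q : K) ^ 2 * (NumberField.discr K : K) := by
    apply ι.injective
    simp only [map_pow, map_sub, map_mul, map_ratCast, map_intCast, hpq]
    rw [← hΔ]; ring
  have hτp : τ α = 2 * p - α := by
    have h1 : (τ α - p) ^ 2 = (α - p) ^ 2 := by
      have := congrArg τ hsq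
      simp only [map_pow, map_sub, map_mul, map_ratCast, map_intCast] at this
      rw [this, hsq]
    rcases sq_eq_sq_iff_eq_or_eq_neg.mp h1 with h | h
    · exact absurd (sub_left_injective h) hτα
    · linear_combination h
  have hιτ : ι (τ α) = p - q * sqrtΔ := by
    rw [hτp, map_sub, map_mul, map_ratCast, hpq, map_ofNat]; ring
  have hAB : ((p : ℂ) + q * sqrtΔ) * (p - q * sqrtΔ) = m := by
    rw [← hpq, ← hιτ, ← map_mul, hτ, map_intCast]
  have hqδ : (q : ℂ) * sqrtΔ ≠ 0 := by
    intro h0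
    apply hτα
    apply ι.injective
    rw [hιτ, hpq, h0]; simp
  have hps : (p : ℂ) + sqrtm ≠ 0 := by
    intro h0
    apply hm'
    rw [← Rat.isSquare_intCast_iff]
    refine ⟨p, ?_⟩
    have h1 : (m : ℂ) = p * p := by rw [← hsqrtm]; linear_combination (sqrtm - p) * h0
    exact_mod_cast h1
  have hcoord (n : ℕ) := QCurve.exists_coordinates hsqrtm hF σ hσ (QCurve.fourierCoeff f n)
  choose x y hx hy using hcoord
  have hcoeff (n : ℕ) : h.coeff n = ι (x n + y n * τ α) := by
    rw [hh, QCurve.hExpansion, PowerSeries.coeff_C_mul, map_add, PowerSeries.coeff_C_mul,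
      QCurve.conjExpansion, PowerSeries.coeff_mk, hy n]
    have h1 : (qExpansion 1 (f : ℍ → ℂ)).coeff n = x n + y n * sqrtm := hx n
    rw [h1, QCurve.normalization_identity hsqrtm hAB (by exact_mod_cast hm0) hqδ hps
      (by rw [hκ, hβ]), map_add, map_mul, map_ratCast, map_ratCast, hιτ]
  have hmem (z : K) := QCurve.mem_seriesDenominator hcoeff (x := z)
  have hint (n : ℕ) : ∃ X Y : ℤ, 2 * x n = X ∧ 2 * y n = Y ∧ 4 ∣ X ^ 2 - m * Y ^ 2 := by
    have h1 : IsIntegral ℤ (QCurve.fourierCoeff f n) :=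
      (isIntegral_algebraMap_iff (algebraMap (QCurve.coeffField f) ℂ).injective).mp
        (hf.isIntegral_coeff n)
    have h2 : IsIntegral ℤ (σ (QCurve.fourierCoeff f n)) := h1.map (σ.restrictScalars ℤ)
    refine QCurve.exists_int_coordinates hm hsqrtm ?_ ?_
    · rw [← hx n]
      exact h1.map ((algebraMap (QCurve.coeffField f) ℂ).toIntAlgHom)
    · rw [← hy n]
      exact h2.map ((algebraMap (QCurve.coeffField f) ℂ).toIntAlgHom)
  choose X Y hX hY hXY using hint
  -- As √m is irrational, a_1 = 1 gives x_1 = 1 and y_1 = 0; this coefficient of h forces its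
  -- denominators to lie in `𝓞 K`.
  have hb1 : (x 1 + y 1 * τ α : K) = 1 := by
    have hs0 : (y 1 : ℂ) * sqrtm = 1 - x 1 := by
      have h1 : (qExpansion 1 (f : ℍ → ℂ)).coeff 1 = x 1 + y 1 * sqrtm := hx 1
      rw [hf.normalized] at h1
      linear_combination -h1
    have hy0 : y 1 = 0 := by
      by_contra hy0
      apply hm'
      rw [← Rat.isSquare_intCast_iff]
      refine ⟨(1 - x 1) / y 1, ?_⟩
      have hyC : (y 1 : ℂ) ≠ 0 := by exact_mod_cast hy0
      have h2 : sqrtm = (1 - x 1) / y 1 := by field_simp; linear_combination hs0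
      have h1 : (m : ℂ) = (1 - x 1) / y 1 * ((1 - x 1) / y 1) := by
        rw [← hsqrtm, sq, ← h2]
      exact_mod_cast h1
    rw [hy0] at hs0 ⊢
    have h3 : (1 : ℂ) = x 1 := by simpa [sub_eq_zero] using hs0.symm
    have h4 : x 1 = 1 := by exact_mod_cast h3.symm
    simp [h4]
  let D : Ideal (𝓞 K) :=
    (QCurve.seriesDenominator ι h).comap (Algebra.linearMap (𝓞 K) K)
  have hD (d : 𝓞 K) : d ∈ D ↔ ∀ n, IsIntegral ℤ ((d : K) * (x n + y n * τ α)) := hmem d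
  have hnorm := QCurve.absNorm_elementDenominator_conj τ α
  have hdvd1 : (m ≡ 2 [ZMOD 4] ∨ m ≡ 3 [ZMOD 4]) →
      Ideal.absNorm D ∣ Ideal.absNorm (QCurve.elementDenominator α) := by
    intro hm4
    have heven (n : ℕ) := QCurve.even_of_four_dvd hm4 (hXY n)
    choose hXe hYe using heven
    choose X' hX' using hXe
    choose Y' hY' using hYe
    have hxX (n : ℕ) : x n = X' n := by
      have := hX n
      rw [hX' n] at this
      push_cast at this
      linarith
    have hyY (n : ℕ) : y n = Y' n := by
      have := hY n
      rw [hY' n] at this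
      push_cast at this
      linarith
    rw [← hnorm]
    refine Ideal.absNorm_dvd_absNorm_of_le (QCurve.elementDenominator_le (x := X') (y := Y') ?_)
    intro d hd
    rw [hD]
    simpa [hxX, hyY] using hd
  have hdvd2 : Ideal.absNorm D ∣ 4 * Ideal.absNorm (QCurve.elementDenominator α) := by
    rw [← hnorm, ← QCurve.absNorm_span_two hK, ← map_mul]
    refine Ideal.absNorm_dvd_absNorm_of_le ?_
    rw [Ideal.span_singleton_mul_le_iff]
    -- The ideal of all d with 2d ∈ D clears the elements 2x_n + 2y_n ᾱ, whose coordinates are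
    -- integers whatever m is modulo 4.
    have hle : QCurve.elementDenominator (τ α) ≤
        Submodule.comap (LinearMap.lsmul (𝓞 K) (𝓞 K) 2) D := by
      refine QCurve.elementDenominator_le (x := X) (y := Y) fun d hd ↦ ?_
      change (2 : 𝓞 K) * d ∈ D
      rw [hD]
      intro n
      convert hd n using 1
      have h1 : (2 * x n : K) = X n := by exact_mod_cast congrArg (Rat.cast (K := K)) (hX n)
      have h2 : (2 * y n : K) = Y n := by exact_mod_cast congrArg (Rat.cast (K := K)) (hY n)
      have h0 : ((2 * d : 𝓞 K) : K) = 2 * d :=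
        (map_mul (algebraMap (𝓞 K) K) 2 d).trans (by rw [map_ofNat])
      rw [← h1, ← h2, h0]
      ring
    exact fun z hz ↦ hle hz
  refine ⟨D, fun z ↦ ⟨fun hz ↦ ?_, ?_⟩, hdvd1, fun _ ↦ hdvd2, fun hint ↦ ?_⟩
  · have h1 := (hmem z).mp hz 1
    rw [hb1, mul_one] at h1
    exact ⟨⟨z, h1⟩, hz, rfl⟩
  · rintro ⟨d, hd, rfl⟩
    exact hd
  · have htop : Ideal.absNorm (QCurve.elementDenominator α) = 1 := by
      rw [QCurve.elementDenominator_eq_top hint, Ideal.absNorm_top]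
    rw [htop] at hdvd1 hdvd2
    refine ⟨fun hm4 ↦ Nat.dvd_one.mp (hdvd1 hm4), fun _ ↦ ?_⟩
    have : Ideal.absNorm D ∈ Nat.divisors 4 := Nat.mem_divisors.mpr ⟨by simpa using hdvd2, by simp⟩
    have h4 : Nat.divisors 4 = {1, 2, 4} := by decide
    rw [h4] at this
    simpa using this
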